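/- Let $\mathcal C$ be a semisimple tensor category over $\mathbb C$: a $\mathbb C$-linear abelian rigid monoidal category whose tensor product is $\mathbb C$-bilinear on morphisms, whose Hom spaces are finite-dimensional, whose objects all have finite length, such that $\mathrm{End}(\mathbf 1)=\mathbb C\,\mathrm{id}_{\mathbf 1}\cong\mathbb C$, and in which every object is a direct sum of simple objects. For each object $X$ let $X^*$ denote its dual, with $\mathrm{ev}_X:X^*\otimes X\to\mathbf 1$ and $\mathrm{coev}_X:\mathbf 1\to X\otimes X^*$. Then $\mathcal C$ is weakly positive: there exists a quasi-pivotal structure on $\mathcal C$, that is, a natural isomorphism $\phi:\mathrm{id}_{\mathcal C}\to(\,)^{**}$ (not required to be monoidal), such that for every nonzero object $X$ of $\mathcal C$ the scalar $$\mathrm{tr}_\phi(\mathrm{id}_X)=\mathrm{ev}_{X^*}\circ(\phi_X\otimes\mathrm{id}_{X^*})\circ\mathrm{coev}_X\in\mathrm{End}(\mathbf 1)=\mathbb C$$ is a positive real number. -/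

import Mathlib

open CategoryTheory MonoidalCategory Limits

namespace TensorCat

universe v u

section Additive

attribute [local instance] Abelian.hasFiniteBiproducts

variable (C : Type u) [Category.{v} C] [Abelian C]

variable {C} in
/-- `X` has a finite filtration `0 = F₀ ⊆ F₁ ⊆ ⋯ ⊆ Fₙ = X` by subobjects, with simple successive
quotients. -/
def HasFiniteLength (X : C) : Prop :=
  ∃ (n : ℕ) (F : Fin (n + 1) → Subobject X), F 0 = ⊥ ∧ F (Fin.last n) = ⊤ ∧
    ∀ i : Fin n, ∃ h : F i.castSucc ≤ F i.succ,
      Simple (cokernel (Subobject.ofLE (F i.castSucc) (F i.succ) h))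

variable {C} in
/-- `X` is a finite (possibly empty) direct sum of simple objects. (For an object of finite length,
a decomposition into a direct sum of simple objects is automatically finite.) -/
def IsSemisimpleObject (X : C) : Prop :=
  ∃ (n : ℕ) (S : Fin n → C), (∀ i, Simple (S i)) ∧ Nonempty (X ≅ ⨁ S)

/-- Every object of `C` is semisimple. -/
def IsSemisimpleCategory : Prop :=
  ∀ X : C, IsSemisimpleObject X

end Additive

/-- The unit object is linear-simple: `c ↦ c • 𝟙` is a bijection (hence an isomorphism of
`k`-algebras) from `k` to `End(𝟙)`. -/
def UnitLinearSimple (k : Type*) [Field k] (C : Type u) [Category.{v} C] [Preadditive C]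
    [Linear k C] [MonoidalCategory C] : Prop :=
  Function.Bijective (fun c : k => (c • 𝟙 (𝟙_ C) : 𝟙_ C ⟶ 𝟙_ C))

/-- A tensor category over `k`: a locally finite `k`-linear abelian rigid monoidal category, with
tensor product `k`-bilinear on morphisms, such that `End(𝟙) = k`. -/
structure IsTensorCategory (k : Type*) [Field k] (C : Type u) [Category.{v} C] [Abelian C]
    [Linear k C] [MonoidalCategory C] [MonoidalPreadditive C] [MonoidalLinear k C]
    [RigidCategory C] : Prop where
  finiteDimensional_hom : ∀ X Y : C, FiniteDimensional k (X ⟶ Y)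
  hasFiniteLength : ∀ X : C, HasFiniteLength X
  unit_linearSimple : UnitLinearSimple k C

section Rigid

variable (C : Type u) [Category.{v} C] [MonoidalCategory C] [RigidCategory C]

/-- The double dual functor `X ↦ X**`, `f ↦ f**`. Here `X*` is the dual of `X` with evaluation
`X* ⊗ X ⟶ 𝟙` and coevaluation `𝟙 ⟶ X ⊗ X*`, which Mathlib calls the right dual `Xᘁ`. -/
@[simps]
noncomputable def doubleDual : C ⥤ C where
  obj X := ((Xᘁ : C)ᘁ : C)
  map f := fᘁᘁ
  map_id X := by simp
  map_comp f g := by simp [comp_rightAdjointMate]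

/-- A quasi-pivotal structure: a natural isomorphism from the identity functor to the double dual
functor, not required to be monoidal. -/
abbrev QuasiPivotalStructure := 𝟭 C ≅ doubleDual C

variable {C}

/-- The trace of `α : X ⟶ X**`, the composite
`𝟙 ⟶ X ⊗ X* ⟶ X** ⊗ X* ⟶ 𝟙` of `coev_X`, `α ⊗ id` and `ev_{X*}`. -/
noncomputable def trace {X : C} (α : X ⟶ ((Xᘁ : C)ᘁ : C)) : 𝟙_ C ⟶ 𝟙_ C :=
  η_ X (Xᘁ : C) ≫ α ▷ (Xᘁ : C) ≫ ε_ (Xᘁ : C) ((Xᘁ : C)ᘁ : C)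

/-- The trace of an endomorphism `f` of `X` with respect to `φ`: the trace of `φ_X ∘ f`. -/
noncomputable def QuasiPivotalStructure.trace (φ : QuasiPivotalStructure C) {X : C} (f : X ⟶ X) :
    𝟙_ C ⟶ 𝟙_ C :=
  TensorCat.trace (f ≫ φ.hom.app X)

end Rigid

/-- A `ℂ`-linear rigid monoidal category with linear-simple unit is weakly positive if it admits a
quasi-pivotal structure `φ` such that, for every nonzero object `X`, the scalar corresponding to the
trace of `id_X` is a positive real number. -/
structure IsWeaklyPositive (C : Type u) [Category.{v} C] [Preadditive C] [Linear ℂ C]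
    [MonoidalCategory C] [RigidCategory C] : Prop where
  unit_linearSimple : UnitLinearSimple ℂ C
  exists_quasiPivotal : ∃ φ : QuasiPivotalStructure C, ∀ X : C, ¬ IsZero X →
    ∃ r : ℝ, 0 < r ∧ φ.trace (𝟙 X) = (r : ℂ) • 𝟙 (𝟙_ C)

end TensorCat

/-! For `X` nonzero, the coevaluation is nonzero; as the unit is simple and every object semisimple,
it has a retraction `X ⊗ X* ⟶ 𝟙`. By duality this retraction comes from a morphism `X ⟶ X**`, which
therefore has trace one. On a simple `S`, Schur's lemma makes this morphism an isomorphism and the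
only one of trace one. Uniqueness and cyclicity of the trace (`trace_comp_comm`) give naturality on
simples, and `exists_natIso_of_simple` extends the family additively. The dimension of `X` is then
its number of simple summands. Since monoidality is not required, the simples can be normalised
independently. -/

namespace TensorCat

/-! ### Decompositions into simple objects -/

section Semisimple

variable {C : Type*} [Category* C] [Preadditive C]

/-- Simple retracts of `X` whose idempotents sum to the identity of `X`. -/
structure SimpleDecomposition (X : C) where
  n : ℕ
  obj : Fin n → C
  simple : ∀ i, Simple (obj i)
  proj : ∀ i, X ⟶ obj i
  incl : ∀ i, obj i ⟶ X
  incl_proj : ∀ i, incl i ≫ proj i = 𝟙 (obj i)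
  sum_proj_incl : ∑ i, proj i ≫ incl i = 𝟙 X

namespace SimpleDecomposition

variable {X : C}

theorem exists_proj_ne_zero (d : SimpleDecomposition X) {W : C} {f : W ⟶ X} (hf : f ≠ 0) :
    ∃ i, f ≫ d.proj i ≠ 0 := by
  by_contra! h
  apply hf
  rw [← Category.comp_id f, ← d.sum_proj_incl, Preadditive.comp_sum]
  exact Finset.sum_eq_zero fun i _ => by rw [← Category.assoc, h i, zero_comp]

theorem n_pos (d : SimpleDecomposition X) (hX : 𝟙 X ≠ 0) : 0 < d.n :=
  let ⟨i, _⟩ := d.exists_proj_ne_zero hX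
  i.pos

/-- A nonzero semisimple object with only scalar endomorphisms is simple. -/
theorem simple_of_scalar_end {k : Type*} [Field k] [Linear k C] (d : SimpleDecomposition X)
    (hX : 𝟙 X ≠ 0) (h : ∀ f : X ⟶ X, ∃ c : k, c • 𝟙 X = f) : Simple X := by
  obtain ⟨i, hi⟩ := d.exists_proj_ne_zero hX
  have := d.simple i
  -- A nonzero idempotent that is a scalar is the identity, so this simple retract is all of `X`.
  obtain ⟨c, hc⟩ := h (d.proj i ≫ d.incl i)
  have hproj : c • d.proj i = d.proj i := by
    have := congrArg (· ≫ d.proj i) hc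
    simpa [d.incl_proj] using this
  have hc1 : c = 1 := by
    by_contra hne
    have : (c - 1) • d.proj i = 0 := by rw [sub_smul, hproj, one_smul, sub_self]
    rcases smul_eq_zero.1 this with h0 | h0
    · exact hne (sub_eq_zero.1 h0)
    · exact hi (by rw [h0, comp_zero])
  rw [hc1, one_smul] at hc
  exact Simple.of_iso ⟨d.proj i, d.incl i, hc.symm, d.incl_proj i⟩

end SimpleDecomposition

section Extension

variable {D : Type*} [Category* D] [Preadditive D] {F G : C ⥤ D} [F.Additive] [G.Additive]

/-- An isomorphism of additive functors is determined by its components on simple objects, if all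
objects decompose into simple objects. -/
theorem exists_natIso_of_simple (d : ∀ X : C, SimpleDecomposition X)
    (φ : ∀ S : C, Simple S → (F.obj S ≅ G.obj S))
    (hφ : ∀ (S T : C) (hS : Simple S) (hT : Simple T) (f : S ⟶ T),
      F.map f ≫ (φ T hT).hom = (φ S hS).hom ≫ G.map f) :
    ∃ Φ : F ≅ G, ∀ (S : C) (hS : Simple S), Φ.hom.app S = (φ S hS).hom := by
  let p (X : C) (i) := φ _ ((d X).simple i)
  let a (X : C) : F.obj X ⟶ G.obj X :=
    ∑ i, F.map ((d X).proj i) ≫ (p X i).hom ≫ G.map ((d X).incl i)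
  let b (X : C) : G.obj X ⟶ F.obj X :=
    ∑ i, G.map ((d X).proj i) ≫ (p X i).inv ≫ F.map ((d X).incl i)
  have sumF (X : C) : ∑ i, F.map ((d X).proj i) ≫ F.map ((d X).incl i) = 𝟙 _ := by
    simp_rw [← F.map_comp]
    rw [← F.map_sum, (d X).sum_proj_incl, F.map_id]
  have sumG (X : C) : ∑ i, G.map ((d X).proj i) ≫ G.map ((d X).incl i) = 𝟙 _ := by
    simp_rw [← G.map_comp]
    rw [← G.map_sum, (d X).sum_proj_incl, G.map_id]
  -- The key point: on morphisms out of simples, `a X` does not depend on the chosen decomposition.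
  -- Naturality and invertibility follow by testing on summands.
  have aS (X S : C) (hS : Simple S) (f : S ⟶ X) :
      F.map f ≫ a X = (φ S hS).hom ≫ G.map f := by
    calc F.map f ≫ a X
        = ∑ i, (φ S hS).hom ≫ G.map f ≫ G.map ((d X).proj i) ≫ G.map ((d X).incl i) := by
          simp only [a, Preadditive.comp_sum]
          refine Finset.sum_congr rfl fun i _ => ?_
          rw [← Category.assoc, ← F.map_comp, ← Category.assoc, hφ S _ hS]
          simp
      _ = _ := by
          rw [← Preadditive.comp_sum, ← Preadditive.comp_sum, sumG, Category.comp_id]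
  have nat {X Y : C} (f : X ⟶ Y) : F.map f ≫ a Y = a X ≫ G.map f := by
    calc F.map f ≫ a Y = ∑ i, F.map ((d X).proj i) ≫ F.map ((d X).incl i ≫ f) ≫ a Y := by
          rw [← Category.id_comp (F.map f), ← sumF, Preadditive.sum_comp, Preadditive.sum_comp]
          simp
      _ = _ := by
          simp only [a, Preadditive.sum_comp]
          refine Finset.sum_congr rfl fun i _ => ?_
          rw [aS _ _ ((d X).simple i)]
          simp [p]
  have ab (X : C) : a X ≫ b X = 𝟙 _ := by
    rw [← sumF X]
    simp only [b, Preadditive.comp_sum]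
    refine Finset.sum_congr rfl fun i _ => ?_
    rw [← Category.assoc, ← nat]
    have h := aS _ _ ((d X).simple i) (𝟙 _)
    simp only [F.map_id, G.map_id, Category.id_comp, Category.comp_id] at h
    rw [h]
    simp [p]
  have ba (X : C) : b X ≫ a X = 𝟙 _ := by
    rw [← sumG X]
    simp only [b, Preadditive.sum_comp]
    refine Finset.sum_congr rfl fun i _ => ?_
    rw [Category.assoc, Category.assoc, aS _ _ ((d X).simple i)]
    simp [p]
  refine ⟨NatIso.ofComponents (fun X => ⟨a X, b X, ab X, ba X⟩) nat, fun S hS => ?_⟩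
  simpa using aS S S hS (𝟙 S)

end Extension

end Semisimple

section

attribute [local instance] Abelian.hasFiniteBiproducts

theorem IsSemisimpleObject.nonempty_simpleDecomposition {C : Type*} [Category* C] [Abelian C]
    {X : C} (h : IsSemisimpleObject X) : Nonempty (SimpleDecomposition X) := by
  obtain ⟨n, S, hS, ⟨e⟩⟩ := h
  refine ⟨⟨n, S, hS, fun i => e.hom ≫ biproduct.π S i, fun i => biproduct.ι S i ≫ e.inv, ?_, ?_⟩⟩
  · simp
  · calc ∑ i, (e.hom ≫ biproduct.π S i) ≫ biproduct.ι S i ≫ e.inv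
        = e.hom ≫ (∑ i, biproduct.π S i ≫ biproduct.ι S i) ≫ e.inv := by
          simp [Preadditive.comp_sum, Preadditive.sum_comp, -biproduct.total]
      _ = 𝟙 X := by simp

end

/-! ### Duals of morphisms and traces -/

section Mate

variable {C : Type*} [Category* C] [MonoidalCategory C] [RigidCategory C]

/-- A morphism and its mate determine each other through the coevaluations; this carries scalar
endomorphisms over to duals. -/
theorem rightAdjointMate_injective (X Y : C) :
    Function.Injective (fun f : X ⟶ Y => (fᘁ : (Yᘁ : C) ⟶ (Xᘁ : C))) := by
  intro f g h
  have h' : η_ X (Xᘁ : C) ≫ f ▷ (Xᘁ : C) = η_ X (Xᘁ : C) ≫ g ▷ (Xᘁ : C) := by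
    rw [← coevaluation_comp_rightAdjointMate, ← coevaluation_comp_rightAdjointMate]
    exact congrArg (fun t => η_ Y (Yᘁ : C) ≫ Y ◁ t) h
  have := congrArg (tensorRightHomEquiv _ X (Xᘁ : C) _).symm h'
  simpa using this

theorem rightAdjointMate_surjective (X Y : C) :
    Function.Surjective (fun f : X ⟶ Y => (fᘁ : (Yᘁ : C) ⟶ (Xᘁ : C))) := by
  intro g
  let f : X ⟶ Y := (λ_ X).inv ≫ (tensorRightHomEquiv _ X (Xᘁ : C) _).symm
    (η_ Y (Yᘁ : C) ≫ Y ◁ g)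
  have hf : η_ X (Xᘁ : C) ≫ f ▷ (Xᘁ : C) = η_ Y (Yᘁ : C) ≫ Y ◁ g := by
    apply (tensorRightHomEquiv _ X (Xᘁ : C) _).symm.injective
    rw [tensorRightHomEquiv_symm_coevaluation_comp_whiskerRight]
    simp [f]
  rw [← coevaluation_comp_rightAdjointMate] at hf
  refine ⟨f, ?_⟩
  have := congrArg (tensorLeftHomEquiv _ Y (Yᘁ : C) _).symm hf
  simpa using this

/-- Every `X ⊗ X* ⟶ 𝟙` comes from a morphism `X ⟶ X**`. -/
theorem exists_whiskerRight_comp_evaluation_eq {X : C} (r : X ⊗ (Xᘁ : C) ⟶ 𝟙_ C) :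
    ∃ a : X ⟶ ((Xᘁ : C)ᘁ : C), a ▷ (Xᘁ : C) ≫ ε_ (Xᘁ : C) ((Xᘁ : C)ᘁ : C) = r := by
  refine ⟨tensorRightHomEquiv _ (Xᘁ : C) ((Xᘁ : C)ᘁ : C) _ r ≫ (λ_ _).hom, ?_⟩
  apply (tensorRightHomEquiv _ (Xᘁ : C) ((Xᘁ : C)ᘁ : C) _).injective
  rw [tensorRightHomEquiv_whiskerRight_comp_evaluation]
  simp

/-- Slide `f` around the loop: it becomes `f*` across the coevaluation, then `f**` across the
evaluation. -/
theorem trace_comp_comm {X Y : C} (f : X ⟶ Y) (b : Y ⟶ ((Xᘁ : C)ᘁ : C)) :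
    trace (f ≫ b) = trace (b ≫ (fᘁᘁ)) := by
  unfold trace
  rw [comp_whiskerRight, comp_whiskerRight, Category.assoc, Category.assoc,
    rightAdjointMate_comp_evaluation, ← Category.assoc (η_ X _),
    ← coevaluation_comp_rightAdjointMate, Category.assoc, whisker_exchange_assoc]

/-- By the zigzag identity, the identity of `X` factors through the whiskered coevaluation. -/
theorem coevaluation_ne_zero [Preadditive C] [MonoidalPreadditive C] {X : C} (hX : 𝟙 X ≠ 0) :
    η_ X (Xᘁ : C) ≠ 0 := by
  intro h
  have := ExactPairing.evaluation_coevaluation X (Xᘁ : C)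
  rw [h, MonoidalPreadditive.zero_whiskerRight, zero_comp] at this
  apply hX
  calc 𝟙 X = (λ_ X).inv ≫ ((λ_ X).hom ≫ (ρ_ X).inv) ≫ (ρ_ X).hom := by simp
    _ = 0 := by rw [← this]; simp

section Preadditive

variable [Preadditive C] [MonoidalPreadditive C]

theorem zero_rightAdjointMate (X Y : C) : ((0 : X ⟶ Y)ᘁ : (Yᘁ : C) ⟶ (Xᘁ : C)) = 0 := by
  simp [rightAdjointMate]

theorem add_rightAdjointMate {X Y : C} (f g : X ⟶ Y) :
    ((f + g)ᘁ : (Yᘁ : C) ⟶ (Xᘁ : C)) = fᘁ + gᘁ := by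
  simp [rightAdjointMate]

instance : (doubleDual C).Additive where
  map_add {X Y f g} := by
    simp only [doubleDual_map, add_rightAdjointMate]
    rfl

theorem trace_sum {ι : Type*} (s : Finset ι) {X : C} (a : ι → (X ⟶ ((Xᘁ : C)ᘁ : C))) :
    trace (∑ i ∈ s, a i) = ∑ i ∈ s, trace (a i) := by
  simp [trace, sum_whiskerRight, Preadditive.sum_comp, Preadditive.comp_sum]

theorem trace_zero (X : C) : trace (0 : X ⟶ ((Xᘁ : C)ᘁ : C)) = 0 := by
  simp [trace]

variable {k : Type*} [Field k] [Linear k C] [MonoidalLinear k C]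

theorem smul_rightAdjointMate {X Y : C} (c : k) (f : X ⟶ Y) :
    ((c • f)ᘁ : (Yᘁ : C) ⟶ (Xᘁ : C)) = c • (fᘁ) := by
  simp [rightAdjointMate]

theorem trace_smul (c : k) {X : C} (a : X ⟶ ((Xᘁ : C)ᘁ : C)) :
    trace (c • a) = c • trace a := by
  simp [trace]

end Preadditive

end Mate

/-! ### Simple objects of a semisimple tensor category -/

section Simple

theorem id_unit_ne_zero {k : Type*} [Field k] {C : Type*} [Category* C] [Preadditive C]
    [Linear k C] [MonoidalCategory C] (h : UnitLinearSimple k C) : 𝟙 (𝟙_ C) ≠ 0 := fun h0 =>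
  one_ne_zero (h.1 (show (1 : k) • 𝟙 (𝟙_ C) = (0 : k) • 𝟙 (𝟙_ C) by simp [h0]))

variable {k : Type*} [Field k] {C : Type*} [Category* C] [Abelian C] [Linear k C]
  [MonoidalCategory C] [MonoidalPreadditive C] [MonoidalLinear k C] [RigidCategory C]

theorem IsTensorCategory.simple_unit (hC : IsTensorCategory k C)
    (hss : IsSemisimpleCategory C) : Simple (𝟙_ C) :=
  (hss _).nonempty_simpleDecomposition.some.simple_of_scalar_end
    (id_unit_ne_zero hC.unit_linearSimple) hC.unit_linearSimple.2

/-- In a semisimple tensor category, a nonzero morphism out of the unit has a retraction. -/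
theorem IsTensorCategory.exists_retraction (hC : IsTensorCategory k C)
    (hss : IsSemisimpleCategory C) {X : C} {f : 𝟙_ C ⟶ X} (hf : f ≠ 0) :
    ∃ r : X ⟶ 𝟙_ C, f ≫ r = 𝟙 _ := by
  have d := (hss X).nonempty_simpleDecomposition.some
  obtain ⟨i, hi⟩ := d.exists_proj_ne_zero hf
  have := hC.simple_unit hss
  have := d.simple i
  have := isIso_of_hom_simple hi
  exact ⟨d.proj i ≫ inv (f ≫ d.proj i), by rw [← Category.assoc, IsIso.hom_inv_id]⟩

/-- Every nonzero object `X` of a semisimple tensor category admits a morphism `X ⟶ X**` of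
trace one. -/
theorem IsTensorCategory.exists_trace_eq_id (hC : IsTensorCategory k C)
    (hss : IsSemisimpleCategory C) {X : C} (hX : 𝟙 X ≠ 0) :
    ∃ a : X ⟶ ((Xᘁ : C)ᘁ : C), trace a = 𝟙 _ := by
  obtain ⟨r, hr⟩ := hC.exists_retraction hss (coevaluation_ne_zero hX)
  obtain ⟨a, ha⟩ := exists_whiskerRight_comp_evaluation_eq r
  exact ⟨a, by rw [trace, ha, hr]⟩

variable [IsAlgClosed k]

/-- By Schur's lemma and duality, the dual is a nonzero semisimple object with only scalar
endomorphisms. -/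
theorem IsTensorCategory.simple_rightDual (hC : IsTensorCategory k C)
    (hss : IsSemisimpleCategory C) (S : C) [Simple S] : Simple (Sᘁ : C) := by
  refine (hss _).nonempty_simpleDecomposition.some.simple_of_scalar_end (k := k) ?_ fun g => ?_
  · intro h
    refine id_nonzero S (rightAdjointMate_injective S S ?_)
    simp only [rightAdjointMate_id, h, zero_rightAdjointMate]
  · obtain ⟨f, rfl⟩ := rightAdjointMate_surjective S S g
    have := hC.finiteDimensional_hom S S
    obtain ⟨c, rfl⟩ := endomorphism_simple_eq_smul_id k f
    exact ⟨c, by simp only [smul_rightAdjointMate, rightAdjointMate_id]⟩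

theorem IsTensorCategory.isIso_of_trace_ne_zero (hC : IsTensorCategory k C)
    (hss : IsSemisimpleCategory C) {S : C} [Simple S] {a : S ⟶ ((Sᘁ : C)ᘁ : C)}
    (ha : trace a ≠ 0) : IsIso a := by
  have := hC.simple_rightDual hss S
  have := hC.simple_rightDual hss (Sᘁ : C)
  exact isIso_of_hom_simple fun h => ha (by rw [h, trace_zero])

/-- On a simple object `S`, a morphism `S ⟶ S**` is determined by its trace. -/
theorem IsTensorCategory.eq_of_trace_eq_id (hC : IsTensorCategory k C)
    (hss : IsSemisimpleCategory C) {S : C} [Simple S] {a b : S ⟶ ((Sᘁ : C)ᘁ : C)}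
    (ha : trace a = 𝟙 _) (hb : trace b = 𝟙 _) : a = b := by
  have h1 := id_unit_ne_zero hC.unit_linearSimple
  have := hC.isIso_of_trace_ne_zero hss (ha.trans_ne h1)
  have := hC.finiteDimensional_hom S S
  obtain ⟨c, hc⟩ := endomorphism_simple_eq_smul_id k (b ≫ inv a)
  have hba : c • a = b := by
    have := congrArg (· ≫ a) hc
    simpa using this
  have hc1 : c = 1 := by
    apply hC.unit_linearSimple.1
    have := trace_smul c a
    rw [hba, ha, hb] at this
    simpa using this.symm
  rw [← hba, hc1, one_smul]

/-- A semisimple tensor category over an algebraically closed field admits a quasi-pivotal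
structure such that all simple objects have dimension one. -/
theorem IsTensorCategory.exists_quasiPivotal (hC : IsTensorCategory k C)
    (hss : IsSemisimpleCategory C) :
    ∃ Φ : QuasiPivotalStructure C, ∀ S : C, Simple S → trace (Φ.hom.app S) = 𝟙 (𝟙_ C) := by
  have h1 := id_unit_ne_zero hC.unit_linearSimple
  choose a ha using fun (S : C) (_ : Simple S) => hC.exists_trace_eq_id hss (id_nonzero S)
  have iso (S : C) (hS : Simple S) : IsIso (a S hS) :=
    hC.isIso_of_trace_ne_zero hss ((ha S hS).trans_ne h1)
  obtain ⟨Φ, hΦ⟩ := exists_natIso_of_simple (F := 𝟭 C) (G := doubleDual C)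
    (fun X => (hss X).nonempty_simpleDecomposition.some) (fun S hS => @asIso _ _ _ _ (a S hS) (iso S hS)) (by
      intro S T hS hT f
      change f ≫ a T hT = a S hS ≫ (fᘁᘁ)
      by_cases hf : f = 0
      · rw [hf, zero_rightAdjointMate, zero_rightAdjointMate, zero_comp, comp_zero]
      have := isIso_of_hom_simple hf
      -- Transporting `a T hT` along `f` preserves its trace, so uniqueness identifies the result
      -- with `a S hS`.
      have h : f ≫ a T hT ≫ ((inv f)ᘁᘁ) = a S hS := by
        refine hC.eq_of_trace_eq_id hss (Eq.trans ?_ (ha T hT)) (ha S hS)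
        rw [← Category.assoc, ← trace_comp_comm, IsIso.inv_hom_id_assoc]
      rw [← h, Category.assoc, Category.assoc, ← comp_rightAdjointMate, ← comp_rightAdjointMate,
        IsIso.inv_hom_id, rightAdjointMate_id, rightAdjointMate_id, Category.comp_id])
  exact ⟨Φ, fun S hS => by rw [hΦ S hS]; exact ha S hS⟩

/-- If all simple objects have dimension one, then the dimension of an object is its number of
simple summands. -/
theorem trace_eq_n_nsmul {C : Type*} [Category* C] [Preadditive C] [MonoidalCategory C]
    [MonoidalPreadditive C] [RigidCategory C] (φ : ∀ X : C, X ⟶ ((Xᘁ : C)ᘁ : C))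
    (nat : ∀ {X Y : C} (f : X ⟶ Y), f ≫ φ Y = φ X ≫ (fᘁᘁ))
    (hφ : ∀ S : C, Simple S → trace (φ S) = 𝟙 (𝟙_ C)) {X : C} (d : SimpleDecomposition X) :
    trace (φ X) = d.n • 𝟙 (𝟙_ C) := by
  calc trace (φ X) = trace (∑ i, d.proj i ≫ d.incl i ≫ φ X) := by
        simp only [← Category.assoc]
        rw [← Preadditive.sum_comp, d.sum_proj_incl, Category.id_comp]
    _ = ∑ i, 𝟙 (𝟙_ C) := by
        rw [trace_sum]
        refine Finset.sum_congr rfl fun i _ => ?_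
        -- Cyclicity and naturality turn each term into the trace on a simple summand.
        rw [trace_comp_comm, ← hφ _ (d.simple i), nat, Category.assoc, ← comp_rightAdjointMate,
          ← comp_rightAdjointMate, d.incl_proj, rightAdjointMate_id, rightAdjointMate_id,
          Category.comp_id]
    _ = d.n • 𝟙 (𝟙_ C) := by simp

end Simple

end TensorCat

theorem theorem6p12 {C : Type*} [Category* C] [Abelian C] [Linear ℂ C]
    [MonoidalCategory C] [MonoidalPreadditive C] [MonoidalLinear ℂ C] [RigidCategory C]
    (hC : TensorCat.IsTensorCategory ℂ C) (hss : TensorCat.IsSemisimpleCategory C) :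
    TensorCat.IsWeaklyPositive C := by
  obtain ⟨Φ, hΦ⟩ := hC.exists_quasiPivotal hss
  refine ⟨hC.unit_linearSimple, Φ, fun X hX => ?_⟩
  have d := (hss X).nonempty_simpleDecomposition.some
  have hn := d.n_pos fun h => hX ((IsZero.iff_id_eq_zero X).2 h)
  refine ⟨d.n, by exact_mod_cast hn, ?_⟩
  rw [Complex.ofReal_natCast, Nat.cast_smul_eq_nsmul,
    ← TensorCat.trace_eq_n_nsmul (fun X => Φ.hom.app X) (fun f => Φ.hom.naturality f) hΦ d]
  exact congrArg TensorCat.trace (Category.id_comp (Φ.hom.app X))
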